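/- Let $S\ge 2$, $N\ge 1$ and $0\le L<C$ be integers and $0\le M\le N$ a real number such that $t=CM/N$ is an integer. Consider $S$ non-colluding servers, each storing the same $N$ files $W_1,\dots,W_N$, which are independent and uniformly distributed on $\{0,1\}^F$, together with $C$ cache nodes and $K=\binom CL$ users, where each user $k$ accesses a set $\mathcal L_k$ of exactly $L$ cache nodes and distinct users access distinct sets. A scheme consists of: a placement, which fills each cache $c\in[C]$ with a function $Z_c$ of the files that occupies at most $MF$ bits and does not depend on the demands; finitely many possible queries, and queries $Q_1,\dots,Q_S$, which the users jointly generate from the demand vector $\mathbf d=(d_1,\dots,d_K)\in[N]^K$ and from private randomness, where $\mathbf d$, the randomness and the files are independent; and, for each server $s$, an answer $A_s$ of fixed bit length $\ell_s$, which is a function of $Q_s$ and the files and is broadcast to all users. The scheme is private if $I(\mathbf d;\,Q_s,Z_{[C]})=0$ for every server $s$, and correct if $H(W_{d_k}\mid \mathbf d, Z_{\mathcal L_k}, Q_{[S]}, A_{[S]})=0$ for every user $k$, in both cases for every probability distribution of $\mathbf d$. Then for every positive integer $F$ divisible by $\binom Ct S^N$ there is a private and correct scheme of rate $$R(t)=\frac{\binom{C}{t+L}}{\binom{C}{t}}\left(1+\frac1S+\cdots+\frac1{S^{N-1}}\right),$$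 that is, the servers together broadcast exactly $\sum_{s}\ell_s=R(t)\,F$ bits; in particular $\frac1F\sum_{s=1}^S H(A_s)\le R(t)$ (entropies in bits) for every probability distribution of $\mathbf d$. -/

import Mathlib

/-!
Multi-access cache-aided multi-user private information retrieval.
All random variables live on finite probability spaces; entropies are in bits.
-/

noncomputable section

namespace MuPIR

section Information

variable {Ω α β : Type} [Fintype α] [Fintype β]

/-- The probability `P(X = a)`, as a real number. -/
def prob {Ω α : Type} (P : PMF Ω) (X : Ω → α) (a : α) : ℝ := (P.map X a).toReal

/-- Shannon entropy `H(X) = - ∑ p(a) log₂ p(a)`. -/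
def entropy (P : PMF Ω) (X : Ω → α) : ℝ :=
  -∑ a, prob P X a * Real.logb 2 (prob P X a)

/-- Conditional entropy `H(X | Y) = - ∑ p(a, b) log₂ (p(a, b) / p(b))`. -/
def condEntropy (P : PMF Ω) (X : Ω → α) (Y : Ω → β) : ℝ :=
  -∑ a, ∑ b, prob P (fun ω => (X ω, Y ω)) (a, b) *
    Real.logb 2 (prob P (fun ω => (X ω, Y ω)) (a, b) / prob P Y b)

/-- Mutual information `I(X ; Y) = ∑ p(a, b) log₂ (p(a, b) / (p(a) p(b)))`. -/
def mutualInfo (P : PMF Ω) (X : Ω → α) (Y : Ω → β) : ℝ :=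
  ∑ a, ∑ b, prob P (fun ω => (X ω, Y ω)) (a, b) *
    Real.logb 2 (prob P (fun ω => (X ω, Y ω)) (a, b) / (prob P X a * prob P Y b))

end Information

/-- The contents of the `N` files, each of `F` bits. -/
abbrev Files (N F : ℕ) : Type := Fin N → Fin F → Bool

/-- The demand vectors of `K` users: user `k` wants the file with index `d k`. -/
abbrev Demand (K N : ℕ) : Type := Fin K → Fin N

/-- A placement and delivery scheme for `S` servers, `N` files of `F` bits each, `C` caches and
`K` users. The placement does not depend on the demands. The users jointly draw private randomness,
and from it and the demand vector they form one query for each server. The answer of a server is a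
function of the query that it received and of the files. -/
structure Scheme (S N C K F : ℕ) where
  /-- the number of bits stored in each cache -/
  cacheLen : Fin C → ℕ
  /-- the placement: the content of each cache, as a function of the files -/
  cache : (c : Fin C) → Files N F → (Fin (cacheLen c) → Bool)
  /-- the values of the private randomness of the users -/
  Rand : Type
  /-- the law of the private randomness -/
  law : PMF Rand
  /-- the set of possible queries to a server -/
  Query : Type
  queryFintype : Fintype Query
  /-- the query sent to each server -/
  query : Fin S → Demand K N → Rand → Query
  /-- the number of bits broadcast by each server -/
  ansLen : Fin S → ℕ
  /-- the answer broadcast by each server -/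
  answer : (s : Fin S) → Query → Files N F → (Fin (ansLen s) → Bool)

attribute [instance] Scheme.queryFintype

namespace Scheme

variable {S N C K F : ℕ} (σ : Scheme S N C K F)

/-- An outcome: demand vector, private randomness of the users, and contents of the files. -/
abbrev Outcome : Type := Demand K N × σ.Rand × Files N F

/-- The joint law: the demand vector has the law `prior`, the files are independent and uniformly
distributed, and demands, private randomness and files are independent of one another. -/
def joint (prior : PMF (Demand K N)) : PMF σ.Outcome :=
  prior.bind fun d => σ.law.bind fun r =>
    (PMF.uniformOfFintype (Files N F)).map fun w => (d, r, w)

/-- the random demand vector `d` -/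
def demandVar (ω : σ.Outcome) : Demand K N := ω.1

/-- the random file `W_n` -/
def fileVar (n : Fin N) (ω : σ.Outcome) : Fin F → Bool := ω.2.2 n

/-- the random file `W_{d_k}` demanded by user `k` -/
def demandedFileVar (k : Fin K) (ω : σ.Outcome) : Fin F → Bool :=
  σ.fileVar (σ.demandVar ω k) ω

/-- the contents `Z_A` of the caches with index in `A` -/
def cacheVar (A : Finset (Fin C)) (ω : σ.Outcome) : (c : A) → (Fin (σ.cacheLen c) → Bool) :=
  fun c => σ.cache c ω.2.2

/-- the query `Q_s` -/
def queryVar (s : Fin S) (ω : σ.Outcome) : σ.Query := σ.query s ω.1 ω.2.1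

/-- the answer `A_s` -/
def answerVar (s : Fin S) (ω : σ.Outcome) : Fin (σ.ansLen s) → Bool :=
  σ.answer s (σ.queryVar s ω) ω.2.2

/-- Every cache can store `M` files, that is `M * F` bits. -/
def FitsMemory (M : ℝ) : Prop := ∀ c, (σ.cacheLen c : ℝ) ≤ M * F

/-- Privacy: `I(d ; Q_s, Z_{[C]}) = 0` for every server `s`, whatever the law of the demands. -/
def IsPrivate : Prop :=
  ∀ (prior : PMF (Demand K N)) (s : Fin S),
    mutualInfo (σ.joint prior) σ.demandVar
      (fun ω => (σ.queryVar s ω, σ.cacheVar Finset.univ ω)) = 0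

/-- Correctness: `H(W_{d_k} | d, Z_{access k}, Q_{[S]}, A_{[S]}) = 0` for every user `k`, where
`access k` is the set of the caches that user `k` is connected to, whatever the law of the
demands. -/
def IsCorrect (access : Fin K → Finset (Fin C)) : Prop :=
  ∀ (prior : PMF (Demand K N)) (k : Fin K),
    condEntropy (σ.joint prior) (σ.demandedFileVar k)
      (fun ω => (σ.demandVar ω, σ.cacheVar (access k) ω,
        (fun s => σ.queryVar s ω), (fun s => σ.answerVar s ω))) = 0

/-- The rate `∑ H(A_s)`, in units of the file size `F`. -/
def rate (prior : PMF (Demand K N)) : ℝ :=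
  (∑ s, entropy (σ.joint prior) (σ.answerVar s)) / F

/-- The total number of bits broadcast by the servers, in units of the file size `F`. -/
def load : ℝ := (∑ s, (σ.ansLen s : ℝ)) / F

end Scheme

end MuPIR

end

/-! Multi-access coded caching is combined with the retrieval scheme of Sun and Jafar. Each file is
cut into subfiles indexed by the `t`-sets `T` of caches, and cache `c` stores those with `c ∈ T`; a
user lacks exactly the `T` disjoint from its access set. For each `(t + L)`-set `A`, every server
broadcasts the sum, over the users `u` with `access u ⊆ A`, of its retrieval answers to `u` on the
subfiles indexed by `A \ access u`. To get `T`, user `k` takes `A = T ∪ access k`: the other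
summands involve only subfiles it has cached, so it can strip them off and decode
(`codedScheme_isCorrect`).

Retrieval (`exists_retrieval`) works on blocks of `S ^ N` symbols. Each sum containing the desired
symbol has an interference part that is empty or is itself sent by another server, so each such sum
yields one desired symbol. A single server sees, for each user and message, an injection followed by
a uniform permutation; its law does not depend on the demand (`codedScheme_isPrivate`). A block
costs `S * ∑ i < N, S ^ i` bits (`card_slot`), which gives the geometric factor of the rate. -/

namespace MuPIR

/-! ### Entropy and uniform laws on finite spaces. -/

section Information

variable {Ω α β : Type}

theorem prob_nonneg (P : PMF Ω) (X : Ω → α) (a : α) : 0 ≤ prob P X a :=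
  ENNReal.toReal_nonneg

theorem sum_prob [Fintype α] (P : PMF Ω) (X : Ω → α) : ∑ a, prob P X a = 1 := by
  unfold prob
  rw [← ENNReal.toReal_sum fun a _ => PMF.apply_ne_top _ a, ← tsum_fintype (L := .unconditional _),
    PMF.tsum_coe, ENNReal.toReal_one]

/-- A random variable that is a function of another one has no conditional entropy given it. -/
theorem condEntropy_eq_zero [Fintype α] [Fintype β] (P : PMF Ω) (X : Ω → α) (Y : Ω → β)
    (h : ∀ ω ω', Y ω = Y ω' → X ω = X ω') : condEntropy P X Y = 0 := by
  unfold condEntropy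
  rw [neg_eq_zero]
  refine Finset.sum_eq_zero fun a _ => Finset.sum_eq_zero fun b _ => ?_
  by_cases h0 : prob P (fun ω => (X ω, Y ω)) (a, b) = 0
  · rw [h0, zero_mul]
  · have hmem : (a, b) ∈ (P.map fun ω => (X ω, Y ω)).support := by
      rw [PMF.mem_support_iff]
      intro h1
      exact h0 (by rw [prob, h1, ENNReal.toReal_zero])
    obtain ⟨ω₀, -, hω₀⟩ := (PMF.mem_support_map_iff _ _ _).1 hmem
    have hX : X ω₀ = a := congrArg Prod.fst hω₀
    have hY : Y ω₀ = b := congrArg Prod.snd hω₀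
    have heq : prob P (fun ω => (X ω, Y ω)) (a, b) = prob P Y b := by
      unfold prob
      rw [PMF.map_apply, PMF.map_apply]
      congr 1
      refine tsum_congr fun ω => ?_
      have hiff : (a, b) = (X ω, Y ω) ↔ b = Y ω := by
        rw [Prod.mk.injEq]
        exact ⟨fun hh => hh.2, fun hh => ⟨hX ▸ h _ _ (hY.trans hh), hh⟩⟩
      by_cases hb : b = Y ω
      · rw [if_pos hb, if_pos (hiff.2 hb)]
      · rw [if_neg hb, if_neg fun hh => hb (hiff.1 hh)]
    rw [← heq, div_self h0, Real.logb_one, mul_zero]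

/-- Independent random variables have no mutual information. -/
theorem mutualInfo_eq_zero [Fintype α] [Fintype β] (P : PMF Ω) (X : Ω → α) (Y : Ω → β)
    (h : ∀ a b, prob P (fun ω => (X ω, Y ω)) (a, b) = prob P X a * prob P Y b) :
    mutualInfo P X Y = 0 := by
  unfold mutualInfo
  refine Finset.sum_eq_zero fun a _ => Finset.sum_eq_zero fun b _ => ?_
  rw [h a b]
  by_cases h0 : prob P X a * prob P Y b = 0
  · rw [h0, zero_mul]
  · rw [div_self h0, Real.logb_one, mul_zero]

/-- The entropy is at most the logarithm of the number of values. -/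
theorem entropy_le_logb_card [Fintype α] (P : PMF Ω) (X : Ω → α) :
    entropy P X ≤ Real.logb 2 (Fintype.card α) := by
  have hne : (Fintype.card α : ℝ) ≠ 0 := by
    intro h
    have : IsEmpty α := Fintype.card_eq_zero_iff.1 (by exact_mod_cast h)
    have h1 := sum_prob P X
    rw [Finset.univ_eq_empty, Finset.sum_empty] at h1
    exact zero_ne_one h1
  have hpos : (0 : ℝ) < Fintype.card α := lt_of_le_of_ne (Nat.cast_nonneg _) hne.symm
  set n : ℝ := (Fintype.card α : ℝ) with hn
  -- Gibbs' inequality against the uniform law, from `log x ≤ x - 1` at `x = 1 / (p n)`; the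
  -- right-hand sides sum to zero.
  have hterm : ∀ a, -(prob P X a * Real.log (prob P X a)) - prob P X a * Real.log n ≤
      1 / n - prob P X a := by
    intro a
    rcases (prob_nonneg P X a).eq_or_lt with h0 | h0
    · rw [← h0]
      simp only [zero_mul, neg_zero, sub_zero]
      positivity
    · have h1 := Real.log_le_sub_one_of_pos (x := 1 / (prob P X a * n)) (by positivity)
      rw [one_div, Real.log_inv, Real.log_mul h0.ne' hne] at h1
      have h2 := mul_le_mul_of_nonneg_left h1 h0.le
      have h3 : prob P X a * ((prob P X a * n)⁻¹ - 1) = 1 / n - prob P X a := by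
        field_simp
      rw [h3] at h2
      linarith
  have hsum := Finset.sum_le_sum fun a (_ : a ∈ Finset.univ) => hterm a
  rw [Finset.sum_sub_distrib, Finset.sum_sub_distrib, ← Finset.sum_mul, sum_prob, Finset.sum_const,
    Finset.card_univ, nsmul_eq_mul, ← hn, mul_one_div_cancel hne, Finset.sum_neg_distrib] at hsum
  have hlog : (0 : ℝ) < Real.log 2 := Real.log_pos one_lt_two
  have hent : entropy P X = (-∑ a, prob P X a * Real.log (prob P X a)) / Real.log 2 := by
    unfold entropy Real.logb
    rw [neg_div, Finset.sum_div]
    simp only [mul_div_assoc]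
  rw [hent, Real.logb]
  gcongr
  linarith

theorem entropy_le_length (P : PMF Ω) {l : ℕ} (X : Ω → (Fin l → Bool)) : entropy P X ≤ l := by
  refine (entropy_le_logb_card P X).trans_eq ?_
  rw [Fintype.card_fun, Fintype.card_bool, Fintype.card_fin, Nat.cast_pow, Nat.cast_ofNat,
    Real.logb_pow, Real.logb_self_eq_one one_lt_two, mul_one]

theorem bind_map_prodMk_apply (p : PMF α) (μ : PMF β) (a : α) (b : β) :
    (p.bind fun x => μ.map (Prod.mk x)) (a, b) = p a * μ b := by
  classical
  have h : ∀ x, (μ.map (Prod.mk x)) (a, b) = if x = a then μ b else 0 := by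
    intro x
    rw [PMF.map_apply]
    by_cases hx : x = a
    · subst hx
      simp
    · have : ∀ y, ¬ (a, b) = (x, y) := fun y hy => hx (congrArg Prod.fst hy).symm
      simp [hx, this]
  rw [PMF.bind_apply]
  simp [h]

/-- A uniform law is invariant under bijections. -/
theorem map_uniformOfFintype_comp_equiv [Fintype α] [Nonempty α] (e : α ≃ α) (f : α → β) :
    (PMF.uniformOfFintype α).map (f ∘ e) = (PMF.uniformOfFintype α).map f := by
  rw [← PMF.map_comp]
  congr 1
  classical
  ext a
  rw [PMF.map_apply, tsum_eq_single (e.symm a)]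
  · simp
  · intro b hb
    rw [if_neg]
    rintro rfl
    exact hb (e.symm_apply_apply b).symm

end Information

/-! ### Privacy and rate of a general scheme. -/

namespace Scheme

variable {S N C K F : ℕ} (σ : Scheme S N C K F)

/-- A scheme in which the law of the query to each server does not depend on the demands is
private. -/
theorem isPrivate_of_map_query
    (h : ∀ s d d', σ.law.map (σ.query s d) = σ.law.map (σ.query s d')) : σ.IsPrivate := by
  intro prior s
  obtain ⟨d₀, -⟩ := prior.support_nonempty
  let Z : Files N F → (c : (Finset.univ : Finset (Fin C))) → (Fin (σ.cacheLen c) → Bool) :=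
    fun w c => σ.cache c w
  -- The law of `(Q_s, Z)` given any demand vector; `d₀` is an arbitrary choice.
  let μ := (σ.law.map (σ.query s d₀)).bind fun q =>
    (PMF.uniformOfFintype (Files N F)).map fun w => (q, Z w)
  have key : (σ.joint prior).map
      (fun ω => (σ.demandVar ω, (σ.queryVar s ω, σ.cacheVar Finset.univ ω))) =
      prior.bind fun d => μ.map (Prod.mk d) := by
    unfold joint
    rw [PMF.map_bind]
    congr 1
    funext d
    rw [PMF.map_bind, PMF.map_bind, h s d₀ d, PMF.bind_map]
    congr 1
    funext r
    rw [PMF.map_comp, Function.comp_apply, PMF.map_comp]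
    rfl
  have hfst : (σ.joint prior).map σ.demandVar = prior := by
    have h1 := congrArg (PMF.map Prod.fst) key
    rw [PMF.map_comp, PMF.map_bind] at h1
    simp only [PMF.map_comp] at h1
    refine h1.trans ((congrArg _ (funext fun d => ?_)).trans prior.bind_pure)
    exact PMF.map_const μ d
  have hsnd : (σ.joint prior).map
      (fun ω => (σ.queryVar s ω, σ.cacheVar Finset.univ ω)) = μ := by
    have h1 := congrArg (PMF.map Prod.snd) key
    rw [PMF.map_comp, PMF.map_bind] at h1
    simp only [PMF.map_comp] at h1
    refine h1.trans ((congrArg _ (funext fun d => ?_)).trans (PMF.bind_const prior μ))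
    exact PMF.map_id μ
  refine mutualInfo_eq_zero _ _ _ fun a b => ?_
  unfold prob
  rw [key, hfst, hsnd, bind_map_prodMk_apply, ENNReal.toReal_mul]

theorem rate_le_load (prior : PMF (Demand K N)) : σ.rate prior ≤ σ.load := by
  unfold rate load
  gcongr
  exact entropy_le_length _ _

end Scheme

/-! ### Sun–Jafar retrieval for a single user. -/

section Retrieval

/-- A position in the answer of a server of the retrieval scheme of Sun and Jafar: a nonempty set
of messages whose symbols are added up, and an index. -/
abbrev Slot (S N : ℕ) : Type :=
  Σ T : {T : Finset (Fin N) // T.Nonempty}, Fin ((S - 1) ^ (T.1.card - 1))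

/-- The messages of which a symbol enters a slot. -/
def Slot.supp {S N : ℕ} (x : Slot S N) : Finset (Fin N) := x.1.1

variable {S N : ℕ}

/-- Adding the empty set, the binomial theorem gives `∑ T, (S - 1) ^ |T| = S ^ N`; the nonempty part
is `S - 1` times the number of slots. -/
theorem card_slot (hS : 2 ≤ S) : Fintype.card (Slot S N) = ∑ i ∈ Finset.range N, S ^ i := by
  have h1 : Fintype.card (Slot S N) =
      ∑ T ∈ (Finset.univ : Finset (Finset (Fin N))).erase ∅, (S - 1) ^ (T.card - 1) := by
    rw [Fintype.card_sigma]
    simp only [Fintype.card_fin]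
    refine (Finset.sum_subtype (p := fun T : Finset (Fin N) => T.Nonempty) _ (fun T => ?_)
      (fun T : Finset (Fin N) => (S - 1) ^ (T.card - 1))).symm
    simp [Finset.nonempty_iff_ne_empty]
  have h2 : Fintype.card (Slot S N) * (S - 1) + 1 = S ^ N := by
    have h3 := Finset.sum_pow_mul_eq_add_pow (S - 1) 1 (Finset.univ : Finset (Fin N))
    rw [Finset.powerset_univ, ← Finset.sum_erase_add _ _ (Finset.mem_univ ∅), Finset.card_univ,
      Fintype.card_fin, Nat.sub_add_cancel (by omega : 1 ≤ S)] at h3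
    simp only [one_pow, mul_one, Finset.card_empty, pow_zero] at h3
    rw [← h3, h1, Finset.sum_mul]
    congr 1
    refine Finset.sum_congr rfl fun T hT => ?_
    rw [← pow_succ, Nat.sub_add_cancel]
    exact Finset.card_pos.2 (Finset.nonempty_iff_ne_empty.2 (Finset.ne_of_mem_erase hT))
  have h4 := Nat.geomSum_eq hS N
  rw [h4, ← h2, Nat.add_sub_cancel, Nat.mul_div_cancel _ (by omega)]

/-- Erasing `n` absorbs the `- 1` in the exponent and leaves the binomial sum over the subsets of
the other `N - 1` messages. -/
theorem card_slot_mem (hS : 2 ≤ S) (n : Fin N) :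
    Fintype.card {x : Slot S N // n ∈ x.supp} = S ^ (N - 1) := by
  classical
  have e : {x : Slot S N // n ∈ x.supp} ≃
      Σ T : {T : Finset (Fin N) // n ∈ T}, Fin ((S - 1) ^ (T.1.card - 1)) :=
    { toFun := fun x => ⟨⟨x.1.1.1, x.2⟩, x.1.2⟩
      invFun := fun y => ⟨⟨⟨y.1.1, ⟨n, y.1.2⟩⟩, y.2⟩, y.1.2⟩
      left_inv := fun _ => rfl
      right_inv := fun _ => rfl }
  rw [Fintype.card_congr e, Fintype.card_sigma]
  simp only [Fintype.card_fin]
  have h3 := Finset.sum_pow_mul_eq_add_pow (S - 1) 1 ((Finset.univ : Finset (Fin N)).erase n)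
  rw [Finset.card_erase_of_mem (Finset.mem_univ n), Finset.card_univ, Fintype.card_fin,
    Nat.sub_add_cancel (by omega : 1 ≤ S)] at h3
  simp only [one_pow, mul_one] at h3
  rw [← h3]
  refine Finset.sum_bij' (fun T _ => T.1.erase n)
    (fun T _ => ⟨insert n T, Finset.mem_insert_self n T⟩) ?_ ?_ ?_ ?_ ?_
  · intro T _
    rw [Finset.mem_powerset]
    exact Finset.erase_subset_erase _ (Finset.subset_univ _)
  · intro T _
    exact Finset.mem_univ _
  · intro T _
    exact Subtype.ext (Finset.insert_erase T.2)
  · intro T hT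
    refine Finset.erase_insert fun h => ?_
    exact Finset.notMem_erase n _ (Finset.mem_powerset.1 hT h)
  · intro T _
    rw [Finset.card_erase_of_mem T.2]

/-- The symbols of message `n` are indexed by a server and a slot that contains `n`. -/
theorem exists_symbol (hS : 2 ≤ S) (n : Fin N) :
    ∃ g : Fin S × Slot S N → Fin (S ^ N),
      Set.BijOn g {y | n ∈ y.2.supp} Set.univ := by
  classical
  have hN : 0 < N := n.pos
  have hcard : Fintype.card {y : Fin S × Slot S N // n ∈ y.2.supp} = S ^ N := by
    have e : {y : Fin S × Slot S N // n ∈ y.2.supp} ≃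
        Fin S × {x : Slot S N // n ∈ x.supp} :=
      { toFun := fun y => (y.1.1, ⟨y.1.2, y.2⟩)
        invFun := fun z => ⟨(z.1, z.2.1), z.2.2⟩
        left_inv := fun _ => rfl
        right_inv := fun _ => rfl }
    rw [Fintype.card_congr e, Fintype.card_prod, Fintype.card_fin, card_slot_mem hS, mul_comm,
      ← pow_succ, Nat.sub_add_cancel hN]
  let e := Fintype.equivFinOfCardEq hcard
  have hpos : 0 < S ^ N := pow_pos (by omega) N
  refine ⟨fun y => if h : n ∈ y.2.supp then e ⟨y, h⟩ else ⟨0, hpos⟩, fun _ _ => Set.mem_univ _,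
    ?_, ?_⟩
  · intro y hy z hz hyz
    have hy' : n ∈ y.2.supp := hy
    have hz' : n ∈ z.2.supp := hz
    simp only [dif_pos hy', dif_pos hz'] at hyz
    exact congrArg Subtype.val (e.injective hyz)
  · intro p _
    refine ⟨(e.symm p).1, (e.symm p).2, ?_⟩
    simp only [dif_pos (e.symm p).2]
    exact e.apply_symm_apply p

/-- Side information: the interference in a slot of server `s` that contains the desired message
`θ` is what another server sends in a slot without `θ`. -/
theorem exists_side (θ : Fin N) (s : Fin S) :
    ∃ h : Slot S N → Fin S × Slot S N,
      (∀ x, θ ∈ x.supp → x.supp ≠ {θ} → (h x).1 ≠ s ∧ (h x).2.supp = x.supp.erase θ) ∧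
      Set.InjOn h {x | θ ∈ x.supp ∧ x.supp ≠ {θ}} := by
  classical
  -- The exponent drops by one when `θ` is erased, so the `(S - 1) ^ (|T| - 1)` copies of `T` match
  -- the copies of `T.erase θ` at the `S - 1` other servers.
  have hfib : ∀ T : {T : Finset (Fin N) // T.Nonempty}, ∀ h : θ ∈ T.1 ∧ T.1 ≠ {θ},
      ∃ hT : (T.1.erase θ).Nonempty, Nonempty (Fin ((S - 1) ^ (T.1.card - 1)) ≃
        {s' : Fin S // s' ≠ s} × Fin ((S - 1) ^ ((T.1.erase θ).card - 1))) := by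
    rintro ⟨T, hT⟩ ⟨h1, h2⟩
    have hT' : (T.erase θ).Nonempty := by
      rw [Finset.nonempty_iff_ne_empty]
      intro h0
      rcases Finset.erase_eq_empty_iff T θ |>.1 h0 with h3 | h3
      · exact hT.ne_empty h3
      · exact h2 h3
    refine ⟨hT', ⟨Fintype.equivOfCardEq ?_⟩⟩
    have h4 : 1 ≤ (T.erase θ).card := hT'.card_pos
    have h5 : (T.erase θ).card = T.card - 1 := Finset.card_erase_of_mem h1
    rw [Fintype.card_prod, Fintype.card_fin, Fintype.card_fin, Fintype.card_subtype_compl,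
      Fintype.card_fin, Fintype.card_subtype_eq, ← pow_succ']
    have h6 : T.card - 1 = (T.erase θ).card - 1 + 1 := by omega
    exact congrArg _ h6
  choose hne he using hfib
  let h : Slot S N → Fin S × Slot S N := fun x =>
    if hx : θ ∈ x.1.1 ∧ x.1.1 ≠ {θ} then
      (((he x.1 hx).some x.2).1.1, ⟨⟨x.1.1.erase θ, hne x.1 hx⟩, ((he x.1 hx).some x.2).2⟩)
    else (s, x)
  refine ⟨h, ?_, ?_⟩
  · intro x h1 h2
    have hx : θ ∈ x.1.1 ∧ x.1.1 ≠ {θ} := ⟨h1, h2⟩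
    simp only [h, dif_pos hx]
    exact ⟨((he x.1 hx).some x.2).1.2, rfl⟩
  · rintro ⟨T, i⟩ hx ⟨T', i'⟩ hx' hh
    have hx1 : θ ∈ T.1 ∧ T.1 ≠ {θ} := hx
    have hx2 : θ ∈ T'.1 ∧ T'.1 ≠ {θ} := hx'
    simp only [h, dif_pos hx1, dif_pos hx2, Prod.mk.injEq, Sigma.mk.injEq, Subtype.mk.injEq] at hh
    have hTT : T = T' := Subtype.ext (by
      rw [← Finset.insert_erase hx1.1, ← Finset.insert_erase hx2.1, hh.2.1])
    subst hTT
    have : (he T hx1).some i = (he T hx1).some i' :=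
      Prod.ext (Subtype.ext hh.1) (eq_of_heq hh.2.2)
    rw [(he T hx1).some.injective this]

/-- What a server learns of each message: which symbol enters each slot. -/
abbrev SlotQuery (S N : ℕ) : Type := (n : Fin N) → {x : Slot S N // n ∈ x.supp} → Fin (S ^ N)

/-- The answer of a server in a slot: the sum of the selected symbols. -/
def slotAnswer (q : SlotQuery S N) (w : Fin N → Fin (S ^ N) → ZMod 2) (x : Slot S N) : ZMod 2 :=
  ∑ n, if h : n ∈ x.supp then w n (q n ⟨x, h⟩) else 0

/-- The retrieval scheme of Sun and Jafar: injections that select the symbols, such that the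
desired message can be decoded after any relabelling of the symbols of the messages. -/
theorem exists_retrieval (hS : 2 ≤ S) (θ : Fin N) :
    ∃ g : Fin S → SlotQuery S N, (∀ s n, Function.Injective (g s n)) ∧
      ∀ (π : Fin N → Equiv.Perm (Fin (S ^ N))) (w w' : Fin N → Fin (S ^ N) → ZMod 2),
        (∀ s x, slotAnswer (fun n y => π n (g s n y)) w x =
          slotAnswer (fun n y => π n (g s n y)) w' x) → w θ = w' θ := by
  classical
  choose sym hsym using exists_symbol (N := N) hS
  choose side hside hinj using exists_side (S := S) θ
  -- The place whose undesired symbols a slot uses: its side-information slot if there is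
  -- interference to cancel, itself otherwise. Within one server no two slots share a home, so no
  -- symbol is selected twice.
  let home : Fin S → Slot S N → Fin S × Slot S N := fun s x =>
    if θ ∈ x.supp ∧ x.supp ≠ {θ} then side s x else (s, x)
  have home_inj : ∀ s, Function.Injective (home s) := by
    intro s x y hxy
    by_cases hx : θ ∈ x.supp ∧ x.supp ≠ {θ} <;> by_cases hy : θ ∈ y.supp ∧ y.supp ≠ {θ}
    · simp only [home, if_pos hx, if_pos hy] at hxy
      exact hinj s hx hy hxy
    · simp only [home, if_pos hx, if_neg hy] at hxy
      exact absurd (congrArg Prod.fst hxy) (hside s x hx.1 hx.2).1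
    · simp only [home, if_neg hx, if_pos hy] at hxy
      exact absurd (congrArg Prod.fst hxy).symm (hside s y hy.1 hy.2).1
    · simp only [home, if_neg hx, if_neg hy] at hxy
      exact congrArg Prod.snd hxy
  have home_mem : ∀ s x n, n ≠ θ → n ∈ x.supp → n ∈ (home s x).2.supp := by
    intro s x n hn hx
    by_cases h : θ ∈ x.supp ∧ x.supp ≠ {θ}
    · simp only [home, if_pos h, (hside s x h.1 h.2).2]
      exact Finset.mem_erase.2 ⟨hn, hx⟩
    · simpa only [home, if_neg h] using hx
  let g : Fin S → SlotQuery S N := fun s n x =>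
    if n = θ then sym n (s, x.1) else sym n (home s x.1)
  refine ⟨g, ?_, ?_⟩
  · intro s n x y hxy
    by_cases hn : n = θ
    · simp only [g, if_pos hn] at hxy
      exact Subtype.ext (congrArg Prod.snd ((hsym n).injOn x.2 y.2 hxy))
    · simp only [g, if_neg hn] at hxy
      exact Subtype.ext (home_inj s
        ((hsym n).injOn (home_mem s x.1 n hn x.2) (home_mem s y.1 n hn y.2) hxy))
  · intro π w w' hans
    funext p
    obtain ⟨⟨s, x⟩, hx, hp⟩ := (hsym θ).surjOn (Set.mem_univ ((π θ).symm p))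
    have hx : θ ∈ x.supp := hx
    let I : (Fin N → Fin (S ^ N) → ZMod 2) → ZMod 2 := fun v =>
      ∑ n ∈ Finset.univ.erase θ, if n ∈ x.supp then v n (π n (sym n (home s x))) else 0
    have hsplit : ∀ v, slotAnswer (fun n y => π n (g s n y)) v x = I v + v θ p := by
      intro v
      unfold slotAnswer
      rw [← Finset.sum_erase_add _ _ (Finset.mem_univ θ)]
      congr 1
      · refine Finset.sum_congr rfl fun n hn => ?_
        have hn' := Finset.ne_of_mem_erase hn
        simp only [g, if_neg hn', dite_eq_ite]
      · simp only [dif_pos hx, g, if_true, hp, Equiv.apply_symm_apply]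
    have hI : I w = I w' := by
      by_cases h1 : x.supp = {θ}
      · have h0 : ∀ v, I v = 0 := fun v => Finset.sum_eq_zero fun n hn => by
          rw [if_neg]
          rw [h1, Finset.mem_singleton]
          exact Finset.ne_of_mem_erase hn
        rw [h0, h0]
      · have hh : home s x = side s x := if_pos ⟨hx, h1⟩
        have hsupp := (hside s x hx h1).2
        set y := side s x with hy
        have hθ : θ ∉ y.2.supp := by
          rw [hsupp]
          exact Finset.notMem_erase θ _
        -- The side slot lacks `θ`, so it is its own home and its answer is exactly the interference
        -- in `x`.
        have hhy : home y.1 y.2 = y := if_neg fun h => hθ h.1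
        have h0 : ∀ v, slotAnswer (fun n z => π n (g y.1 n z)) v y.2 = I v := by
          intro v
          unfold slotAnswer
          rw [← Finset.sum_erase_add _ _ (Finset.mem_univ θ), dif_neg hθ, add_zero]
          refine Finset.sum_congr rfl fun n hn => ?_
          have hn' := Finset.ne_of_mem_erase hn
          simp only [g, if_neg hn', dite_eq_ite, hhy, hh]
          refine if_congr ?_ rfl rfl
          rw [hsupp, Finset.mem_erase]
          exact ⟨fun h => h.2, fun h => ⟨hn', h⟩⟩
        rw [← h0, ← h0, hans]
    have h2 := hans s x
    rw [hsplit, hsplit, hI] at h2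
    exact add_left_cancel h2

/-- Two injections into a finite type differ by a permutation of it. -/
theorem exists_perm_comp_eq {α β : Type} [Finite β] (f g : α → β) (hf : Function.Injective f)
    (hg : Function.Injective g) : ∃ τ : Equiv.Perm β, ∀ a, τ (f a) = g a := by
  classical
  have := Fintype.ofFinite β
  let e := (Equiv.ofInjective f hf).symm.trans (Equiv.ofInjective g hg)
  refine ⟨e.extendSubtype, fun a => ?_⟩
  rw [Equiv.extendSubtype_apply_of_mem e (f a) ⟨a, rfl⟩]
  have : (⟨f a, ⟨a, rfl⟩⟩ : Set.range f) = Equiv.ofInjective f hf a := rfl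
  simp only [e, Equiv.trans_apply]
  erw [this, Equiv.symm_apply_apply]
  rfl

end Retrieval

/-! ### Placement and coded delivery for all users. -/

section Delivery

variable {S N C L K F t m : ℕ}

/-- Bits as elements of the field with two elements. -/
def bitEquiv : Bool ≃ ZMod 2 := finTwoEquiv.symm

/-- The part of the files that is cached by the nodes in `T`, in the division of the files given by
`e`. -/
def subfile (e : {T : Finset (Fin C) // T.card = t} × Fin m × Fin (S ^ N) ≃ Fin F)
    (w : Files N F) (T : Finset (Fin C)) (j : Fin m) (n : Fin N) (p : Fin (S ^ N)) : ZMod 2 :=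
  -- The default is harmless: `A \ access u` has `t` elements if `|A| = t + L`, `|access u| = L` and
  -- `access u ⊆ A`.
  if h : T.card = t then bitEquiv (w n (e (⟨T, h⟩, j, p))) else 0

/-- The bit broadcast for the set `A` of caches and the slot `x`: the sum of the retrieval answers
to the users that access caches in `A` only. -/
def delivery (e : {T : Finset (Fin C) // T.card = t} × Fin m × Fin (S ^ N) ≃ Fin F)
    (access : Fin K → Finset (Fin C)) (q : Fin K → SlotQuery S N) (w : Files N F)
    (A : Finset (Fin C)) (j : Fin m) (x : Slot S N) : ZMod 2 :=
  ∑ u, if access u ⊆ A then slotAnswer (q u) (subfile e w (A \ access u) j) x else 0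

/-- The coded delivery of the retrieval answers for the subfiles that the users lack, where
`g θ s` selects the symbols that server `s` sends for the demand `θ`. -/
noncomputable def codedScheme (L : ℕ)
    (e : {T : Finset (Fin C) // T.card = t} × Fin m × Fin (S ^ N) ≃ Fin F)
    (access : Fin K → Finset (Fin C)) (g : Fin N → Fin S → SlotQuery S N) :
    Scheme S N C K F where
  cacheLen c := Fintype.card
    (Fin N × {T : Finset (Fin C) // T.card = t ∧ c ∈ T} × Fin m × Fin (S ^ N))
  cache c w i :=
    let z := (Fintype.equivFin _).symm i
    w z.1 (e (⟨z.2.1, z.2.1.2.1⟩, z.2.2))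
  Rand := Fin K → Fin N → Equiv.Perm (Fin (S ^ N))
  law := PMF.uniformOfFintype _
  Query := Fin K → SlotQuery S N
  queryFintype := inferInstance
  query s d π u n x := π u n (g (d u) s n x)
  ansLen _ := Fintype.card ({A : Finset (Fin C) // A.card = t + L} × Fin m × Slot S N)
  answer _ q w i :=
    let z := (Fintype.equivFin _).symm i
    bitEquiv.symm (delivery e access q w z.1 z.2.1 z.2.2)

variable (e : {T : Finset (Fin C) // T.card = t} × Fin m × Fin (S ^ N) ≃ Fin F)
  (access : Fin K → Finset (Fin C)) (g : Fin N → Fin S → SlotQuery S N)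

theorem codedScheme_isPrivate (hg : ∀ θ s n, Function.Injective (g θ s n)) :
    (codedScheme L e access g).IsPrivate := by
  refine Scheme.isPrivate_of_map_query _ fun s d d' => ?_
  choose τ hτ using fun (u : Fin K) (n : Fin N) =>
    exists_perm_comp_eq (g (d' u) s n) (g (d u) s n) (hg _ _ _) (hg _ _ _)
  -- Right multiplication by `τ` turns the query for `d'` into the query for `d` and preserves the
  -- uniform law.
  let E : (Fin K → Fin N → Equiv.Perm (Fin (S ^ N))) ≃ (Fin K → Fin N → Equiv.Perm (Fin (S ^ N))) :=
    Equiv.piCongrRight fun u => Equiv.piCongrRight fun n => Equiv.mulRight (τ u n)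
  refine Eq.trans ?_ (map_uniformOfFintype_comp_equiv E ((codedScheme L e access g).query s d'))
  change PMF.map _ (PMF.uniformOfFintype (Fin K → Fin N → Equiv.Perm (Fin (S ^ N)))) = _
  congr 1
  funext π u n x
  change π u n (g (d u) s n x) = π u n (τ u n (g (d' u) s n x))
  rw [hτ]

theorem subfile_injective {w w' : Files N F} {n : Fin N}
    (h : ∀ T : Finset (Fin C), T.card = t → ∀ j p, subfile e w T j n p = subfile e w' T j n p) :
    w n = w' n := by
  funext i
  obtain ⟨⟨⟨T, hT⟩, j, p⟩, rfl⟩ := e.surjective i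
  have h1 := h T hT j p
  unfold subfile at h1
  rw [dif_pos hT, dif_pos hT] at h1
  exact bitEquiv.injective h1

theorem codedScheme_isCorrect (hcard : ∀ k, (access k).card = L)
    (hinj : Function.Injective access)
    (hg : ∀ θ (π : Fin N → Equiv.Perm (Fin (S ^ N))) (w w' : Fin N → Fin (S ^ N) → ZMod 2),
      (∀ s x, slotAnswer (fun n y => π n (g θ s n y)) w x =
        slotAnswer (fun n y => π n (g θ s n y)) w' x) → w θ = w' θ) :
    (codedScheme L e access g).IsCorrect access := by
  intro prior k
  refine condEntropy_eq_zero _ _ _ ?_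
  rintro ⟨d, π, w⟩ ⟨d', π', w'⟩ hY
  simp only [Prod.mk.injEq] at hY
  obtain ⟨hd, hZ, hQ, hA⟩ := hY
  change d = d' at hd
  subst hd
  change w (d k) = w' (d k)
  -- Only the queries are known to agree, not `π` and `π'`; both outcomes are decoded with `π`.
  let q : Fin S → Fin K → SlotQuery S N := fun s u n x => π u n (g (d u) s n x)
  have hQ' : ∀ s, (codedScheme L e access g).query s d π' = q s := fun s => (congrFun hQ s).symm
  -- the subfiles in the caches of the user
  have hcache : ∀ T : Finset (Fin C), ¬ Disjoint T (access k) →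
      subfile e w T = subfile e w' T := by
    intro T hT
    funext j n p
    unfold subfile
    by_cases hc : T.card = t
    · rw [dif_pos hc, dif_pos hc]
      obtain ⟨c, hcT, hck⟩ := Finset.not_disjoint_iff.1 hT
      have h1 := congrFun (congrFun hZ ⟨c, hck⟩)
        (Fintype.equivFin (Fin N × {T : Finset (Fin C) // T.card = t ∧ c ∈ T} × Fin m ×
          Fin (S ^ N)) (n, ⟨T, hc, hcT⟩, j, p))
      simp only [Scheme.cacheVar, codedScheme, Equiv.symm_apply_apply] at h1
      rw [h1]
    · rw [dif_neg hc, dif_neg hc]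
  have hdel : ∀ s (A : Finset (Fin C)), A.card = t + L → ∀ j x,
      delivery e access (q s) w A j x = delivery e access (q s) w' A j x := by
    intro s A hA' j x
    have h1 := congrFun (congrFun hA s)
      (Fintype.equivFin ({A : Finset (Fin C) // A.card = t + L} × Fin m × Slot S N)
        (⟨A, hA'⟩, j, x))
    simp only [Scheme.answerVar, Scheme.queryVar, hQ'] at h1
    simp only [codedScheme, Equiv.symm_apply_apply] at h1
    exact bitEquiv.symm.injective h1
  refine subfile_injective e fun T hT j p => ?_
  by_cases hdisj : Disjoint T (access k)
  · have hTA : (T ∪ access k) \ access k = T := Finset.union_sdiff_cancel_right hdisj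
    have hAcard : (T ∪ access k).card = t + L := by
      rw [Finset.card_union_of_disjoint hdisj, hT, hcard]
    refine congrFun (hg (d k) (π k) (subfile e w T j) (subfile e w' T j) fun s x => ?_) p
    have h1 := hdel s _ hAcard j x
    unfold delivery at h1
    rw [← Finset.sum_erase_add _ _ (Finset.mem_univ k),
      ← Finset.sum_erase_add _ _ (Finset.mem_univ k), if_pos Finset.subset_union_right,
      if_pos Finset.subset_union_right, hTA] at h1
    refine add_left_cancel (h1.trans (congrArg (· + _) (Finset.sum_congr rfl fun u hu => ?_).symm))
    by_cases hu' : access u ⊆ T ∪ access k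
    · rw [if_pos hu', if_pos hu', hcache]
      intro hdis
      -- If `A \ access u` missed `access k`, then `access k ⊆ access u`; equal sizes and
      -- injectivity would force `u = k`.
      have hsub : access k ⊆ access u := by
        intro c hc
        by_contra hcu
        exact Finset.disjoint_left.1 hdis
          (Finset.mem_sdiff.2 ⟨Finset.mem_union_right _ hc, hcu⟩) hc
      have := Finset.eq_of_subset_of_card_le hsub (by rw [hcard, hcard])
      exact Finset.ne_of_mem_erase hu (hinj this.symm)
    · rw [if_neg hu', if_neg hu']
  · rw [hcache T hdisj]

/-- Obtained from the complementary count `(C - 1).choose t` of the `t`-sets avoiding `c`; this form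
avoids `t - 1` and so covers `t = 0`. -/
theorem card_finset_card_mem_mul (c : Fin C) (htC : t ≤ C) :
    Fintype.card {T : Finset (Fin C) // T.card = t ∧ c ∈ T} * C = t * C.choose t := by
  have h1 : Fintype.card {T : Finset (Fin C) // T.card = t ∧ c ∈ T} + (C - 1).choose t =
      C.choose t := by
    have h2 := Finset.card_filter_add_card_filter_not
      (s := Finset.powersetCard t (Finset.univ : Finset (Fin C))) (fun T => c ∈ T)
    rw [Finset.card_powersetCard, Finset.card_univ, Fintype.card_fin] at h2
    rw [← h2, Fintype.card_subtype]
    congr 1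
    · congr 1
      ext T
      simp
    · have h3 := Finset.card_powersetCard t ((Finset.univ : Finset (Fin C)).erase c)
      rw [Finset.card_erase_of_mem (Finset.mem_univ c), Finset.card_univ, Fintype.card_fin] at h3
      rw [← h3]
      congr 1
      ext T
      simp only [Finset.mem_powersetCard, Finset.mem_filter, Finset.subset_univ, true_and,
        Finset.subset_erase]
      exact and_comm
  obtain ⟨C, rfl⟩ : ∃ C', C = C' + 1 := ⟨C - 1, by have := c.pos; omega⟩
  have h4 := Nat.choose_mul_succ_eq C t
  rw [Nat.add_sub_cancel] at h1
  zify [htC] at h1 h4 ⊢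
  linear_combination (C + 1 : ℤ) * h1 - h4

/-- Each cache holds the fraction `t / C = M / N` of every file, so the bound is attained. -/
theorem codedScheme_fitsMemory (M : ℝ) (hN : 1 ≤ N) (htC : t ≤ C)
    (ht : (t : ℝ) = C * M / N) : (codedScheme L e access g).FitsMemory M := by
  intro c
  have hF : F = C.choose t * (m * S ^ N) := by
    have := Fintype.card_congr e
    simpa using this.symm
  have hN' : (N : ℝ) ≠ 0 := by positivity
  have hC' : (C : ℝ) ≠ 0 := Nat.cast_ne_zero.2 c.pos.ne'
  have h1 : (Fintype.card {T : Finset (Fin C) // T.card = t ∧ c ∈ T} : ℝ) * C =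
      t * C.choose t := by exact_mod_cast card_finset_card_mem_mul c htC
  have h2 : (t : ℝ) * N = C * M := by
    rw [ht]
    field_simp
  refine le_of_eq ?_
  simp only [codedScheme, Fintype.card_prod, Fintype.card_fin]
  rw [hF]
  push_cast
  apply mul_left_cancel₀ hC'
  linear_combination (N * (m * (S : ℝ) ^ N)) * h1 + (C.choose t * (m * (S : ℝ) ^ N)) * h2

theorem codedScheme_load (hS : 2 ≤ S) (hF : 0 < F) :
    (codedScheme L e access g).load = (C.choose (t + L) : ℝ) / (C.choose t : ℝ) *
      ∑ i ∈ Finset.range N, 1 / (S : ℝ) ^ i := by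
  have hF' : F = C.choose t * (m * S ^ N) := by
    have := Fintype.card_congr e
    simpa using this.symm
  have hS' : (S : ℝ) ≠ 0 := by positivity
  have hchoose : (C.choose t : ℝ) ≠ 0 := by
    rintro h
    rw [Nat.cast_eq_zero.1 h, zero_mul] at hF'
    omega
  have hm : (m : ℝ) ≠ 0 := by
    rintro h
    rw [Nat.cast_eq_zero.1 h, zero_mul, mul_zero] at hF'
    omega
  have hbig : Fintype.card {A : Finset (Fin C) // A.card = t + L} = C.choose (t + L) := by
    simp
  -- The geometric sum read backwards: `S ^ N / S ^ i = S * S ^ (N - 1 - i)`.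
  have hgeom : (S : ℝ) ^ N * ∑ i ∈ Finset.range N, 1 / (S : ℝ) ^ i =
      S * ∑ i ∈ Finset.range N, (S : ℝ) ^ i := by
    rw [← Finset.sum_range_reflect (fun i => (S : ℝ) ^ i), Finset.mul_sum, Finset.mul_sum]
    refine Finset.sum_congr rfl fun i hi => ?_
    have hi' := Finset.mem_range.1 hi
    rw [mul_one_div, div_eq_iff (pow_ne_zero _ hS'), mul_assoc, ← pow_add, ← pow_succ']
    congr 1
    omega
  unfold Scheme.load
  simp only [codedScheme, Finset.sum_const, Finset.card_univ, Fintype.card_fin, nsmul_eq_mul]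
  rw [Fintype.card_prod, Fintype.card_prod, Fintype.card_fin, hbig, card_slot hS, hF']
  push_cast
  field_simp
  linear_combination -(C.choose (t + L) : ℝ) * hgeom

end Delivery

end MuPIR

theorem theorem1 (S N C L K : ℕ) (hS : 2 ≤ S) (hN : 1 ≤ N) (hL : L < C)
    (hK : K = C.choose L)
    (access : Fin K → Finset (Fin C))
    (haccess_card : ∀ k, (access k).card = L)
    (haccess_inj : Function.Injective access)
    (M : ℝ) (hM_nonneg : 0 ≤ M) (hM_le : M ≤ N)
    (t : ℕ) (ht : (t : ℝ) = C * M / N)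
    (R : ℝ)
    (hR : R = (C.choose (t + L) : ℝ) / (C.choose t : ℝ) *
      ∑ i ∈ Finset.range N, 1 / (S : ℝ) ^ i)
    (F : ℕ) (hF : 0 < F) (hdvd : C.choose t * S ^ N ∣ F) :
    ∃ σ : MuPIR.Scheme S N C K F,
      σ.FitsMemory M ∧ σ.IsPrivate ∧ σ.IsCorrect access ∧
        σ.load = R ∧ ∀ prior : PMF (MuPIR.Demand K N), σ.rate prior ≤ R := by
  obtain ⟨m, hm⟩ := hdvd
  have htC : t ≤ C := by
    by_contra h
    rw [Nat.choose_eq_zero_of_lt (not_le.1 h), zero_mul, zero_mul] at hm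
    omega
  have e : {T : Finset (Fin C) // T.card = t} × Fin m × Fin (S ^ N) ≃ Fin F :=
    Fintype.equivFinOfCardEq (by simp [hm]; ring)
  choose g hg_inj hg_dec using MuPIR.exists_retrieval (N := N) hS
  have hload := MuPIR.codedScheme_load (L := L) e access g hS hF
  exact ⟨MuPIR.codedScheme L e access g,
    MuPIR.codedScheme_fitsMemory e access g M hN htC ht,
    MuPIR.codedScheme_isPrivate e access g hg_inj,
    MuPIR.codedScheme_isCorrect e access g haccess_card haccess_inj hg_dec,
    hload.trans hR.symm,
    fun prior => (MuPIR.Scheme.rate_le_load _ prior).trans_eq (hload.trans hR.symm)⟩
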